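/- Let $m\in\mathbb{N}$ and $(c_1,\dots,c_m)\in[0,1]^m$. Given a statistical model $(\mathbb{P}_\vartheta)_{\vartheta\in\Theta}$, null hypotheses $\Theta_j\subseteq\Theta$, test statistics $T_j$ and rejection regions $\Gamma_j(\alpha)\subseteq\mathbb{R}$, $\alpha\in(0,1)$, the LFC-based $p$-values are $$p_j^{LFC}=\inf_{\alpha\in(0,1):\,T_j\in\Gamma_j(\alpha)}\ \sup_{\vartheta\in\Theta_j}\mathbb{P}_\vartheta\big(T_j\in\Gamma_j(\alpha)\big).$$ Let $U_1,\dots,U_m$ be random variables on the same probability space which, under every $\vartheta\in\Theta$, are jointly independent, uniformly distributed on $[0,1]$, and jointly independent of the data. The randomized $p$-values are $$p_j^{rand}=U_j\mathbf 1\{p_j^{LFC}\ge c_j\}+\frac{p_j^{LFC}}{c_j}\mathbf 1\{p_j^{LFC}<c_j\},\qquad p_j^{rand}=U_j\ \text{ if } c_j=0 .$$ Such a $p$-value is called valid if $\mathbb{P}_\vartheta(p_j^{rand}\le t)\le t$ for all $\vartheta\in\Theta_j$ and all $t\in[0,1]$. In each of the following two models, $p_j^{rand}$ is valid for every $j=1,\dots,m$.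 (i) Multiple $Z$-tests model. Let $n_j\ge 1$. The parameter $\vartheta$ consists of an arbitrary mean vector $(\vartheta_1,\dots,\vartheta_m)\in\mathbb{R}^m$ and, possibly, a nuisance parameter. For each $j$, the observations $X_{1,j},\dots,X_{n_j,j}$ are independent and $N(\vartheta_j,1)$-distributed under $\mathbb{P}_\vartheta$; nothing is assumed about the dependence between different $j$. The null hypothesis is $\Theta_j=\{\vartheta:\vartheta_j\le 0\}$, the test statistic is $T_j=n_j^{-1}\sum_{i=1}^{n_j}X_{i,j}$, and $\Gamma_j(\alpha)=(\Phi^{-1}_{(0,1/n_j)}(1-\alpha),\infty)$, where $\Phi_{(0,1/n_j)}$ is the distribution function of $N(0,1/n_j)$. (ii) Two-sample $t$-test model. Let $n_{1,j},n_{2,j}\ge 1$ with $\nu_j:=n_{1,j}+n_{2,j}-2\ge 1$. The parameter $\vartheta$ consists of arbitrary means $\theta_{1,j},\theta_{2,j}\in\mathbb{R}$ and variances $\sigma_j^2>0$, $j=1,\dots,m$, and, possibly, a nuisance parameter. For each $j$, the observations $X_{1,j},\dots,X_{n_{1,j},j},Y_{1,j},\dots,Y_{n_{2,j},j}$ are jointly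 independent under $\mathbb{P}_\vartheta$, with $X_{i,j}\sim N(\theta_{1,j},\sigma_j^2)$ and $Y_{i,j}\sim N(\theta_{2,j},\sigma_j^2)$; nothing is assumed about the dependence between different $j$. The null hypothesis is $\Theta_j=\{\vartheta:\theta_{1,j}-\theta_{2,j}\le 0\}$. With the sample means $\bar X_j,\bar Y_j$, the test statistic is $$T_j=\sqrt{\frac{n_{1,j}n_{2,j}}{n_{1,j}+n_{2,j}}}\;\frac{\bar X_j-\bar Y_j}{S_j},\qquad S_j^2=\frac{1}{\nu_j}\Big[\sum_{i=1}^{n_{1,j}}(X_{i,j}-\bar X_j)^2+\sum_{i=1}^{n_{2,j}}(Y_{i,j}-\bar Y_j)^2\Big],\ S_j\ge 0,$$ and $\Gamma_j(\alpha)=(F_{t_{\nu_j}}^{-1}(1-\alpha),\infty)$, where $F_{t_{\nu_j}}$ is the distribution function of Student's $t$-distribution with $\nu_j$ degrees of freedom. -/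

import Mathlib

open MeasureTheory ProbabilityTheory Set
open scoped NNReal ENNReal

noncomputable section

/-! ### Multiple testing: LFC-based and randomized p-values, validity -/

/-- The quantile function `F⁻¹(p) = inf {x | p ≤ F(x)}` of a probability measure on `ℝ`. -/
def quantile (μ : Measure ℝ) (p : ℝ) : ℝ := sInf {x : ℝ | p ≤ cdf μ x}

/-- The LFC-based p-value of a marginal test with test statistic `T`, rejection regions `Γ α`
for `α ∈ (0, 1)`, and null hypothesis `null` (a set of parameters), in the statistical model `P`:
`inf_{α ∈ (0,1), T(ω) ∈ Γ(α)} sup_{ϑ ∈ null} P_ϑ(T ∈ Γ(α))`. -/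
def lfcPValue {Θ Ω : Type*} [MeasurableSpace Ω] (P : Θ → Measure Ω) (null : Set Θ)
    (T : Ω → ℝ) (Γ : ℝ → Set ℝ) (ω : Ω) : ℝ :=
  sInf ((fun α : ℝ => sSup ((fun ϑ : Θ => (P ϑ).real (T ⁻¹' Γ α)) '' null)) ''
    {α : ℝ | α ∈ Ioo (0 : ℝ) 1 ∧ T ω ∈ Γ α})

/-- The randomized p-value `u 1{p ≥ c} + (p / c) 1{p < c}` built from the LFC-based p-value `p`,
the randomizing variable `u` and the constant `c`; by convention it is `u` for `c = 0`. -/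
def randPValue (p u c : ℝ) : ℝ :=
  if c = 0 then u else if c ≤ p then u else p / c

/-- A (random) p-value is valid for the null hypothesis `null` if it is stochastically not smaller
than the uniform distribution on `[0, 1]` under every parameter in `null`. -/
def IsValidPValue {Θ Ω : Type*} [MeasurableSpace Ω] (P : Θ → Measure Ω) (null : Set Θ)
    (p : Ω → ℝ) : Prop :=
  ∀ ϑ ∈ null, ∀ t ∈ Icc (0 : ℝ) 1, P ϑ {ω | p ω ≤ t} ≤ ENNReal.ofReal t

/-- Under every parameter, `U₁, …, Uₘ` are jointly independent, uniformly distributed on `[0, 1]`,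
and (as a family) independent of the data `D`. -/
structure IsRandomization {Θ Ω 𝓓 : Type*} [MeasurableSpace Ω] [MeasurableSpace 𝓓] {m : ℕ}
    (P : Θ → Measure Ω) (D : Ω → 𝓓) (U : Fin m → Ω → ℝ) : Prop where
  measurable : ∀ j, Measurable (U j)
  uniform : ∀ ϑ j, HasLaw (U j) (volume.restrict (Icc (0 : ℝ) 1)) (P ϑ)
  iIndep : ∀ ϑ, iIndepFun U (P ϑ)
  indep_data : ∀ ϑ, IndepFun (fun ω j => U j ω) D (P ϑ)

/-! ### The multiple Z-tests model -/

/-- Parameters of the multiple Z-tests model: the `m` means, ranging over all of `ℝᵐ`, and a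
nuisance parameter (e.g. the dependency structure between the `m` samples). -/
structure ZParam (m : ℕ) (N : Type*) where
  mean : Fin m → ℝ
  nuisance : N

/-- For each `j`, the observations `X_{1,j}, …, X_{n_j,j}` are independent and `N(ϑ_j, 1)`.
Nothing is assumed about the dependence between samples with different `j`. -/
structure IsZTestsModel {m : ℕ} {N Ω : Type*} [MeasurableSpace Ω] (n : Fin m → ℕ)
    (P : ZParam m N → Measure Ω) (X : (j : Fin m) → Fin (n j) → Ω → ℝ) : Prop where
  isProbabilityMeasure : ∀ ϑ, IsProbabilityMeasure (P ϑ)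
  measurable : ∀ j i, Measurable (X j i)
  law : ∀ ϑ j i, HasLaw (X j i) (gaussianReal (ϑ.mean j) 1) (P ϑ)
  iIndep : ∀ ϑ j, iIndepFun (X j) (P ϑ)

/-- The mean of a sample of size `n`. -/
def sampleMean {n : ℕ} {Ω : Type*} (X : Fin n → Ω → ℝ) (ω : Ω) : ℝ :=
  (n : ℝ)⁻¹ * ∑ i, X i ω

/-- The rejection region `(Φ_{(0, 1/n)}⁻¹(1 - α), ∞)`. -/
def zRejection (n : ℕ) (α : ℝ) : Set ℝ :=
  Ioi (quantile (gaussianReal 0 ((n : ℝ≥0)⁻¹)) (1 - α))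

/-- The null hypothesis `H_j : ϑ_j ≤ 0`. -/
def zNull {m : ℕ} {N : Type*} (j : Fin m) : Set (ZParam m N) :=
  {ϑ | ϑ.mean j ≤ 0}

/-! ### The two-sample means comparison model -/

/-- Parameters of the two-sample model: all means, all (positive) variances, and a nuisance
parameter (e.g. the dependency structure between different coordinates `j`). -/
structure TwoSampleParam (m : ℕ) (N : Type*) where
  mean₁ : Fin m → ℝ
  mean₂ : Fin m → ℝ
  var : Fin m → ℝ≥0
  var_pos : ∀ j, 0 < var j
  nuisance : N

/-- For each `j`, the observations `X_{1,j}, …, X_{n₁ⱼ,j}, Y_{1,j}, …, Y_{n₂ⱼ,j}` are jointly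
independent, with `X_{i,j} ∼ N(θ_{1,j}, σ_j²)` and `Y_{i,j} ∼ N(θ_{2,j}, σ_j²)`.
Nothing is assumed about the dependence between different `j`. -/
structure IsTwoSampleModel {m : ℕ} {N Ω : Type*} [MeasurableSpace Ω] (n₁ n₂ : Fin m → ℕ)
    (P : TwoSampleParam m N → Measure Ω) (X : (j : Fin m) → Fin (n₁ j) → Ω → ℝ)
    (Y : (j : Fin m) → Fin (n₂ j) → Ω → ℝ) : Prop where
  isProbabilityMeasure : ∀ ϑ, IsProbabilityMeasure (P ϑ)
  measurable_fst : ∀ j i, Measurable (X j i)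
  measurable_snd : ∀ j i, Measurable (Y j i)
  law_fst : ∀ ϑ j i, HasLaw (X j i) (gaussianReal (ϑ.mean₁ j) (ϑ.var j)) (P ϑ)
  law_snd : ∀ ϑ j i, HasLaw (Y j i) (gaussianReal (ϑ.mean₂ j) (ϑ.var j)) (P ϑ)
  iIndep : ∀ ϑ j, iIndepFun (Sum.elim (X j) (Y j)) (P ϑ)

/-- The pooled sample variance of two samples. -/
def pooledVariance {n₁ n₂ : ℕ} {Ω : Type*} (X : Fin n₁ → Ω → ℝ) (Y : Fin n₂ → Ω → ℝ)
    (ω : Ω) : ℝ :=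
  ((n₁ : ℝ) + n₂ - 2)⁻¹ *
    (∑ i, (X i ω - sampleMean X ω) ^ 2 + ∑ i, (Y i ω - sampleMean Y ω) ^ 2)

/-- The two-sample t-statistic. -/
def tStatistic {n₁ n₂ : ℕ} {Ω : Type*} (X : Fin n₁ → Ω → ℝ) (Y : Fin n₂ → Ω → ℝ)
    (ω : Ω) : ℝ :=
  √((n₁ : ℝ) * n₂ / (n₁ + n₂)) * (sampleMean X ω - sampleMean Y ω) / √(pooledVariance X Y ω)

/-- Student's t-distribution with `ν` degrees of freedom: the law of `Z / √(V / ν)`, where `Z` is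
standard normal and `V`, independent of `Z`, is chi-squared with `ν` degrees of freedom, that is,
the sum of the squares of `ν` independent standard normal variables. -/
def studentT (ν : ℕ) : Measure ℝ :=
  ((gaussianReal 0 1).prod (Measure.pi fun _ : Fin ν => gaussianReal 0 1)).map
    fun z => z.1 / √((∑ i, z.2 i ^ 2) / ν)

/-- The rejection region `(F_{t_ν}⁻¹(1 - α), ∞)` with `ν = n₁ + n₂ - 2`. -/
def tRejection (n₁ n₂ : ℕ) (α : ℝ) : Set ℝ :=
  Ioi (quantile (studentT (n₁ + n₂ - 2)) (1 - α))

/-- The null hypothesis `H_j : θ_{1,j} - θ_{2,j} ≤ 0`. -/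
def twoSampleNull {m : ℕ} {N : Type*} (j : Fin m) : Set (TwoSampleParam m N) :=
  {ϑ | ϑ.mean₁ j - ϑ.mean₂ j ≤ 0}

end

/-! ### Likelihood ratios and upper sets -/

/-! Let `μ` be the law of `T` at the boundary of the null hypothesis and `F` its distribution
function. In both models every null law `ν` of `T` has a density ratio to `μ` that decreases, so
`ν(A) / ν(B) ≤ μ(A) / μ(B)` for upper sets `A ⊆ B` (`UpperTailLE`). Taking `B` to be the whole line
shows that the boundary is least favourable, whence `p = 1 - F(T)` (`lfcPValue_eq_one_sub_cdf`).
Taking `A` and `B` to be the events `p ≤ t c` and `p < c`, of `μ`-mass `t c` and `c`, gives `ν(A) ≤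
t ν(B)`. The randomized p-value is at most `t` either through `u ≤ t` on `p ≥ c`, with probability
at most `t ν(Bᶜ)` by independence, or through `A`; the two bounds add up to `t`
(`isValidPValue_randPValue`).

For Z-tests the ratio is that of two Gaussians with equal variance. For t-tests, rotating the
standardized sample shows that `T` is noncentral t with parameter `δ ≤ 0` (`hasLaw_tStatistic`), and
a rescaling of the chi variables factors its density so that the ratio is visibly monotone
(`noncentralTPDF_eq`). -/

/-- Splitting `B` into `A` and `B \ A`, both sides contain the same `A × A` term, and the remaining
terms compare pointwise on `A × (B \ A)`. Nothing is subtracted, so infinite integrals do no harm.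
-/
theorem setLIntegral_mul_setLIntegral_le {E : Type*} [MeasurableSpace E] {σ : Measure E}
    {f g : E → ℝ≥0∞} (hf : Measurable f) (hg : Measurable g) {A B : Set E}
    (hA : MeasurableSet A) (hB : MeasurableSet B) (hAB : A ⊆ B)
    (h : ∀ a ∈ A, ∀ b ∈ B \ A, f a * g b ≤ f b * g a) :
    (∫⁻ x in A, f x ∂σ) * ∫⁻ x in B, g x ∂σ ≤ (∫⁻ x in B, f x ∂σ) * ∫⁻ x in A, g x ∂σ := by
  have split : ∀ k : E → ℝ≥0∞,
      ∫⁻ x in B, k x ∂σ = (∫⁻ x in A, k x ∂σ) + ∫⁻ x in B \ A, k x ∂σ := fun k => by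
    rw [← lintegral_union (hB.diff hA) disjoint_sdiff_right, union_sdiff_cancel hAB]
  rw [split f, split g, mul_add, add_mul]
  refine add_le_add le_rfl ?_
  rw [← lintegral_lintegral_mul hf.aemeasurable hg.aemeasurable, mul_comm (∫⁻ x in B \ A, f x ∂σ),
    ← lintegral_lintegral_mul hg.aemeasurable hf.aemeasurable]
  refine setLIntegral_mono' hA fun a ha => setLIntegral_mono' (hB.diff hA) fun b hb => ?_
  rw [mul_comm (g a)]
  exact h a ha b hb

/-- `ν` has a smaller upper tail than `μ`, uniformly over conditioning on upper sets. -/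
def UpperTailLE (ν μ : Measure ℝ) : Prop :=
  ∀ A B : Set ℝ, IsUpperSet A → IsUpperSet B → A ⊆ B → ν A * μ B ≤ ν B * μ A

theorem IsUpperSet.measurableSet_real {A : Set ℝ} (hA : IsUpperSet A) : MeasurableSet A :=
  hA.ordConnected.measurableSet

/-- Since `A` is an upper set, each of its points lies above each point of `B \ A`, so a monotone
likelihood ratio, written without division, is enough. -/
theorem upperTailLE_withDensity {f g : ℝ → ℝ≥0∞} (hf : Measurable f) (hg : Measurable g)
    (h : ∀ a b, b ≤ a → f a * g b ≤ f b * g a) :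
    UpperTailLE (volume.withDensity f) (volume.withDensity g) := by
  intro A B hA hB hAB
  have hA' := hA.measurableSet_real
  have hB' := hB.measurableSet_real
  rw [withDensity_apply _ hA', withDensity_apply _ hB', withDensity_apply _ hA',
    withDensity_apply _ hB']
  refine setLIntegral_mul_setLIntegral_le hf hg hA' hB' hAB fun a ha b hb => h a b ?_
  by_contra! hab
  exact hb.2 (hA hab.le ha)

/-! ### Continuous distribution functions -/

section Cdf

variable {μ : Measure ℝ}

theorem bddBelow_setOf_le_cdf {y : ℝ} (hy : 0 < y) : BddBelow {x : ℝ | y ≤ cdf μ x} := by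
  obtain ⟨a, ha⟩ := ((tendsto_cdf_atBot μ).eventually (eventually_lt_nhds hy)).exists
  refine ⟨a, fun x hx => ?_⟩
  by_contra! hxa
  exact absurd (hx.trans (monotone_cdf μ hxa.le)) (not_le.2 ha)

theorem quantile_le {x y : ℝ} (hy : 0 < y) (h : y ≤ cdf μ x) : quantile μ y ≤ x :=
  csInf_le (bddBelow_setOf_le_cdf hy) h

variable [IsProbabilityMeasure μ]

theorem continuous_cdf [NullSingletonClass μ] : Continuous (cdf μ) := by
  rw [continuous_iff_continuousAt]
  intro x
  rw [(monotone_cdf μ).continuousAt_iff_leftLim_eq_rightLim, (cdf μ).rightLim_eq]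
  have h : (cdf μ).measure {x} = 0 := by rw [measure_cdf]; exact measure_singleton x
  rw [StieltjesFunction.measure_singleton, ENNReal.ofReal_eq_zero] at h
  exact le_antisymm ((monotone_cdf μ).leftLim_le le_rfl) (by linarith)

theorem measureReal_Ioi_eq_one_sub_cdf (x : ℝ) : μ.real (Ioi x) = 1 - cdf μ x := by
  rw [cdf_eq_real, ← compl_Iic, probReal_compl_eq_one_sub measurableSet_Iic]

theorem exists_cdf_eq [NullSingletonClass μ] {y : ℝ} (hy : y ∈ Ioo (0 : ℝ) 1) : ∃ x, cdf μ x = y := by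
  obtain ⟨a, ha⟩ := ((tendsto_cdf_atBot μ).eventually (eventually_lt_nhds hy.1)).exists
  obtain ⟨b, hb⟩ := ((tendsto_cdf_atTop μ).eventually (eventually_gt_nhds hy.2)).exists
  exact mem_range_of_exists_le_of_exists_ge continuous_cdf ⟨a, ha.le⟩ ⟨b, hb.le⟩

theorem le_cdf_of_quantile_lt [NullSingletonClass μ] {x y : ℝ} (hy : y ∈ Ioo (0 : ℝ) 1)
    (h : quantile μ y < x) : y ≤ cdf μ x := by
  obtain ⟨a, ha⟩ := exists_cdf_eq (μ := μ) hy
  obtain ⟨z, hz, hzx⟩ := exists_lt_of_csInf_lt ⟨a, ha.ge⟩ h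
  exact le_trans hz (monotone_cdf μ hzx.le)

theorem quantile_lt_of_lt_cdf [NullSingletonClass μ] {x y : ℝ} (hy : y ∈ Ioo (0 : ℝ) 1)
    (h : y < cdf μ x) : quantile μ y < x := by
  obtain ⟨a, ha⟩ := exists_cdf_eq (μ := μ) hy
  refine (quantile_le hy.1 ha.ge).trans_lt ?_
  by_contra! hxa
  exact absurd (monotone_cdf μ hxa) (by rw [ha]; exact not_le.2 h)

theorem cdf_quantile [NullSingletonClass μ] {y : ℝ} (hy : y ∈ Ioo (0 : ℝ) 1) : cdf μ (quantile μ y) = y := by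
  obtain ⟨a, ha⟩ := exists_cdf_eq (μ := μ) hy
  refine le_antisymm ((monotone_cdf μ (quantile_le hy.1 ha.ge)).trans_eq ha) ?_
  -- Every point to the right of the quantile has `F ≥ y`; continuity carries this to the quantile
  -- itself.
  refine ge_of_tendsto (continuous_cdf.continuousAt.mono_left nhdsWithin_le_nhds :
    Filter.Tendsto (cdf μ) (nhdsWithin (quantile μ y) (Ioi (quantile μ y))) _) ?_
  filter_upwards [self_mem_nhdsWithin] with x hx
  exact le_cdf_of_quantile_lt hy hx

/-- The level `y` is approached by `z < y` in `(0, 1)`, because `F` need not attain the value `1`.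
-/
theorem measure_setOf_le_cdf_le [NullSingletonClass μ] {y : ℝ} (hy : y ∈ Icc (0 : ℝ) 1) :
    μ {x | y ≤ cdf μ x} ≤ ENNReal.ofReal (1 - y) := by
  rcases hy.1.eq_or_lt with rfl | h0
  · simpa using prob_le_one
  refine ge_of_tendsto (x := nhdsWithin y (Iio y)) (f := fun z => ENNReal.ofReal (1 - z)) ?_ ?_
  · exact ((ENNReal.continuous_ofReal.comp (continuous_const.sub continuous_id)).tendsto y).mono_left nhdsWithin_le_nhds
  · filter_upwards [Ioo_mem_nhdsLT h0] with z hz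
    obtain ⟨a, ha⟩ := exists_cdf_eq (μ := μ) ⟨hz.1, hz.2.trans_le hy.2⟩
    rw [← ha, ← measureReal_Ioi_eq_one_sub_cdf, ofReal_measureReal]
    refine measure_mono fun x hx => ?_
    by_contra! hxa
    have := monotone_cdf μ (not_lt.1 hxa)
    have : y ≤ cdf μ x := hx
    linarith [hz.2]

theorem measure_setOf_cdf_le_le [NullSingletonClass μ] {y : ℝ} (hy : y ∈ Icc (0 : ℝ) 1) :
    μ {x | cdf μ x ≤ y} ≤ ENNReal.ofReal y := by
  rcases hy.2.eq_or_lt with rfl | h1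
  · simpa using prob_le_one
  refine ge_of_tendsto (x := nhdsWithin y (Ioi y)) (f := fun z => ENNReal.ofReal z) ?_ ?_
  · exact (ENNReal.continuous_ofReal.tendsto y).mono_left nhdsWithin_le_nhds
  · filter_upwards [Ioo_mem_nhdsGT h1] with z hz
    obtain ⟨a, ha⟩ := exists_cdf_eq (μ := μ) ⟨hy.1.trans_lt hz.1, hz.2⟩
    rw [← ha, ofReal_cdf]
    refine measure_mono fun x hx => ?_
    by_contra! hxa
    have := monotone_cdf μ (not_le.1 hxa).le
    have : cdf μ x ≤ y := hx
    linarith [hz.1]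

theorem ofReal_le_measure_setOf_lt_cdf [NullSingletonClass μ] {y : ℝ} (hy : y ∈ Icc (0 : ℝ) 1) :
    ENNReal.ofReal (1 - y) ≤ μ {x | y < cdf μ x} := by
  have hm : MeasurableSet {x | cdf μ x ≤ y} :=
    measurableSet_le continuous_cdf.measurable measurable_const
  have h : {x | y < cdf μ x} = {x | cdf μ x ≤ y}ᶜ := by ext; simp
  rw [h, prob_compl_eq_one_sub hm, ENNReal.ofReal_sub _ hy.1, ENNReal.ofReal_one]
  exact tsub_le_tsub_left (measure_setOf_cdf_le_le hy) _

/-- Proportional tail bound of a distribution with smaller upper tail than `μ`, at the levels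
`t * c` and `c` of the survival function of `μ`. -/
theorem UpperTailLE.measure_one_sub_cdf_le [NullSingletonClass μ] {ν : Measure ℝ} [IsProbabilityMeasure ν]
    (h : UpperTailLE ν μ) {t c : ℝ} (ht : t ∈ Icc (0 : ℝ) 1) (hc : c ∈ Ioc (0 : ℝ) 1) :
    ν {x | 1 - cdf μ x ≤ t * c ∧ 1 - cdf μ x < c} ≤
      ENNReal.ofReal t * ν {x | 1 - cdf μ x < c} := by
  set B : Set ℝ := {x | 1 - c < cdf μ x}
  have hB : {x | 1 - cdf μ x < c} = B := by ext x; simp only [B, mem_ofPred_eq]; constructor <;>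
    intro <;> linarith
  -- For `t < 1` and `c > 0` the first condition implies membership in `B`; the intersection matters
  -- only at `t = 1`, where it removes the boundary `1 - F = c`.
  set A : Set ℝ := {x | 1 - t * c ≤ cdf μ x} ∩ B
  have hA : {x | 1 - cdf μ x ≤ t * c ∧ 1 - cdf μ x < c} = A := by
    ext x; simp only [A, B, mem_ofPred_eq, mem_inter_iff]
    constructor <;> rintro ⟨_, _⟩ <;> constructor <;> linarith
  rw [hA, hB]
  have htc : t * c ∈ Icc (0 : ℝ) 1 := ⟨mul_nonneg ht.1 hc.1.le, mul_le_one₀ ht.2 hc.1.le hc.2⟩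
  have huB : IsUpperSet B := fun x y hxy hx => lt_of_lt_of_le hx (monotone_cdf μ hxy)
  have huA : IsUpperSet A := IsUpperSet.inter
    (fun x y hxy hx => le_trans (show _ ≤ cdf μ x from hx) (monotone_cdf μ hxy)) huB
  have key := h A B huA huB inter_subset_right
  have hμB : ENNReal.ofReal c ≤ μ B := by
    have := ofReal_le_measure_setOf_lt_cdf (μ := μ) (y := 1 - c)
      ⟨by linarith [hc.2], by linarith [hc.1]⟩
    simpa using this
  have hμA : μ A ≤ ENNReal.ofReal (t * c) := by
    refine (measure_mono inter_subset_left).trans ?_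
    have := measure_setOf_le_cdf_le (μ := μ) (y := 1 - t * c)
      ⟨by linarith [htc.2], by linarith [htc.1]⟩
    simpa using this
  have hc0 : ENNReal.ofReal c ≠ 0 := by simpa using hc.1
  have h2 : ν A * ENNReal.ofReal c ≤ ENNReal.ofReal t * ν B * ENNReal.ofReal c := calc
    ν A * ENNReal.ofReal c ≤ ν A * μ B := by gcongr
    _ ≤ ν B * μ A := key
    _ ≤ ν B * ENNReal.ofReal (t * c) := by gcongr
    _ = _ := by rw [ENNReal.ofReal_mul ht.1]; ring
  exact (ENNReal.mul_le_mul_iff_left hc0 ENNReal.ofReal_ne_top).1 h2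

end Cdf

/-! ### Validity of randomized p-values -/

section Validity

variable {Θ Ω : Type*} [MeasurableSpace Ω] {P : Θ → Measure Ω} {null : Set Θ} {T : Ω → ℝ}
  {Γ : ℝ → Set ℝ} {μ : Measure ℝ} [IsProbabilityMeasure μ]

theorem UpperTailLE.le_of_isUpperSet {ν : Measure ℝ} [IsProbabilityMeasure ν]
    (h : UpperTailLE ν μ) {A : Set ℝ} (hA : IsUpperSet A) : ν A ≤ μ A := by
  simpa using h A univ hA isUpperSet_univ (subset_univ A)

theorem lfcPValue_eq_one_sub_cdf [NullSingletonClass μ] (hpos : ∀ x, 0 < cdf μ x)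
    (hΓ : ∀ α, Γ α = Ioi (quantile μ (1 - α))) (hT : Measurable T)
    (hP : ∀ ϑ, IsProbabilityMeasure (P ϑ))
    (htail : ∀ ϑ ∈ null, UpperTailLE ((P ϑ).map T) μ)
    (hlfc : ∃ ϑ ∈ null, (P ϑ).map T = μ) (ω : Ω) :
    lfcPValue P null T Γ ω = 1 - cdf μ (T ω) := by
  have hsup : ∀ α ∈ Ioo (0 : ℝ) 1,
      sSup ((fun ϑ : Θ => (P ϑ).real (T ⁻¹' Γ α)) '' null) = α := by
    intro α hα
    have hα' : 1 - α ∈ Ioo (0 : ℝ) 1 := ⟨by linarith [hα.2], by linarith [hα.1]⟩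
    have hμ : μ.real (Γ α) = α := by
      rw [hΓ, measureReal_Ioi_eq_one_sub_cdf, cdf_quantile hα', sub_sub_cancel]
    have hmap : ∀ ϑ, (P ϑ).real (T ⁻¹' Γ α) = ((P ϑ).map T).real (Γ α) := fun ϑ => by
      rw [map_measureReal_apply hT (hΓ α ▸ measurableSet_Ioi)]
    -- The supremum is attained at the least favourable parameter, where the rejection probability
    -- is exactly `α`.
    refine IsGreatest.csSup_eq ⟨?_, ?_⟩
    · obtain ⟨ϑ, hϑ, h⟩ := hlfc
      exact ⟨ϑ, hϑ, by simp only [hmap, h, hμ]⟩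
    · rintro _ ⟨ϑ, hϑ, rfl⟩
      have := hP ϑ
      have := Measure.isProbabilityMeasure_map (μ := P ϑ) hT.aemeasurable
      simp only [hmap]
      conv_rhs => rw [← hμ]
      refine ENNReal.toReal_mono (measure_ne_top _ _) ((htail ϑ hϑ).le_of_isUpperSet ?_)
      rw [hΓ]
      exact isUpperSet_Ioi _
  have himg : (fun α : ℝ => sSup ((fun ϑ : Θ => (P ϑ).real (T ⁻¹' Γ α)) '' null)) ''
      {α : ℝ | α ∈ Ioo (0 : ℝ) 1 ∧ T ω ∈ Γ α} = {α : ℝ | α ∈ Ioo (0 : ℝ) 1 ∧ T ω ∈ Γ α} :=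
    (image_congr fun α hα => hsup α hα.1).trans (image_id _)
  have hlt : ∀ w, 1 - cdf μ (T ω) < w → ∃ α ∈ {α : ℝ | α ∈ Ioo (0 : ℝ) 1 ∧ T ω ∈ Γ α}, α < w := by
    intro w hw
    -- Positivity of `F` leaves room for `α` below `1`. If `F (T ω)` were `0`, no level would reject
    -- and the infimum of the empty set would be `0`, not `1`.
    obtain ⟨α, h1, h2⟩ := exists_between (lt_min hw (show 1 - cdf μ (T ω) < 1 by
      linarith [hpos (T ω)]))
    have h0 : 0 < α := by linarith [cdf_le_one μ (T ω)]
    have h3 := lt_min_iff.1 h2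
    refine ⟨α, ⟨⟨h0, h3.2⟩, ?_⟩, h3.1⟩
    rw [hΓ]
    exact quantile_lt_of_lt_cdf ⟨by linarith, by linarith⟩ (by linarith)
  rw [lfcPValue, himg]
  refine csInf_eq_of_forall_ge_of_forall_gt_exists_lt ?_ ?_ hlt
  · obtain ⟨α, hα, -⟩ := hlt _ (lt_add_one _)
    exact ⟨α, hα⟩
  · rintro α ⟨hα, hTα⟩
    rw [hΓ] at hTα
    have := le_cdf_of_quantile_lt ⟨by linarith [hα.2], by linarith [hα.1]⟩ hTα
    linarith

theorem measure_uniform_le {ρ : Measure Ω} {u : Ω → ℝ}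
    (hu : HasLaw u (volume.restrict (Icc (0 : ℝ) 1)) ρ) {t : ℝ} :
    ρ {ω | u ω ≤ t} ≤ ENNReal.ofReal t := by
  rw [hu.measure_eq (p := fun x => x ≤ t) measurableSet_Iic]
  refine (Measure.restrict_apply measurableSet_Iic).trans_le ?_
  refine (measure_mono (t := Icc 0 t) fun x hx => ⟨hx.2.1, hx.1⟩).trans ?_
  simp

theorem isValidPValue_randPValue [NullSingletonClass μ] (hpos : ∀ x, 0 < cdf μ x)
    (hΓ : ∀ α, Γ α = Ioi (quantile μ (1 - α))) (hT : Measurable T)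
    (hP : ∀ ϑ, IsProbabilityMeasure (P ϑ))
    (htail : ∀ ϑ ∈ null, UpperTailLE ((P ϑ).map T) μ)
    (hlfc : null.Nonempty → ∃ ϑ ∈ null, (P ϑ).map T = μ) {u : Ω → ℝ}
    (hu : ∀ ϑ, HasLaw u (volume.restrict (Icc (0 : ℝ) 1)) (P ϑ))
    (hind : ∀ ϑ, IndepFun u T (P ϑ)) {c : ℝ} (hc : c ∈ Icc (0 : ℝ) 1) :
    IsValidPValue P null fun ω => randPValue (lfcPValue P null T Γ ω) (u ω) c := by
  intro ϑ hϑ t ht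
  have := hP ϑ
  have := Measure.isProbabilityMeasure_map (μ := P ϑ) hT.aemeasurable
  simp only [lfcPValue_eq_one_sub_cdf hpos hΓ hT hP htail (hlfc ⟨ϑ, hϑ⟩)]
  rcases hc.1.eq_or_lt with rfl | hc0
  · simpa [randPValue] using measure_uniform_le (hu ϑ)
  have hF : Measurable fun x => 1 - cdf μ x := measurable_const.sub continuous_cdf.measurable
  set C : Set ℝ := {x | c ≤ 1 - cdf μ x}
  have hC : MeasurableSet C := measurableSet_le measurable_const hF
  have hCc : Cᶜ = {x | 1 - cdf μ x < c} := by ext; simp [C]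
  set D : Set ℝ := {x | 1 - cdf μ x ≤ t * c ∧ 1 - cdf μ x < c}
  have hD : MeasurableSet D :=
    (measurableSet_le hF measurable_const).inter (measurableSet_lt hF measurable_const)
  -- On `C` the p-value is `u`, which is independent of `T`; off `C` it is a function of `T` alone,
  -- and the event becomes `D`.
  have hsub : {ω | randPValue (1 - cdf μ (T ω)) (u ω) c ≤ t} ⊆
      (u ⁻¹' Iic t ∩ T ⁻¹' C) ∪ T ⁻¹' D := by
    intro ω hω
    simp only [randPValue, hc0.ne', if_false, mem_ofPred_eq] at hω
    split_ifs at hω with h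
    · exact Or.inl ⟨hω, h⟩
    · exact Or.inr ⟨(div_le_iff₀ hc0).1 hω, not_le.1 h⟩
  calc P ϑ {ω | randPValue (1 - cdf μ (T ω)) (u ω) c ≤ t}
      ≤ P ϑ (u ⁻¹' Iic t ∩ T ⁻¹' C) + P ϑ (T ⁻¹' D) :=
        (measure_mono hsub).trans (measure_union_le _ _)
    _ = P ϑ (u ⁻¹' Iic t) * (P ϑ).map T C + (P ϑ).map T D := by
        rw [(hind ϑ).measure_inter_preimage_eq_mul _ _ measurableSet_Iic hC,
          Measure.map_apply hT hC, Measure.map_apply hT hD]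
    _ ≤ ENNReal.ofReal t * (P ϑ).map T C + ENNReal.ofReal t * (P ϑ).map T Cᶜ := by
        rw [hCc]
        exact add_le_add (mul_le_mul_left (measure_uniform_le (hu ϑ)) _)
          ((htail ϑ hϑ).measure_one_sub_cdf_le ht ⟨hc0, hc.2⟩)
    _ = ENNReal.ofReal t := by rw [← mul_add, prob_add_prob_compl hC, mul_one]

end Validity

/-! ### Gaussian samples -/

theorem upperTailLE_gaussianReal {m : ℝ} (hm : m ≤ 0) {v : ℝ≥0} (hv : v ≠ 0) :
    UpperTailLE (gaussianReal m v) (gaussianReal 0 v) := by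
  rw [gaussianReal_of_var_ne_zero _ hv, gaussianReal_of_var_ne_zero _ hv]
  refine upperTailLE_withDensity (measurable_gaussianPDF _ _) (measurable_gaussianPDF _ _)
    fun a b hab => ?_
  rw [gaussianPDF, gaussianPDF, gaussianPDF, gaussianPDF,
    ← ENNReal.ofReal_mul (gaussianPDFReal_nonneg _ _ _),
    ← ENNReal.ofReal_mul (gaussianPDFReal_nonneg _ _ _)]
  refine ENNReal.ofReal_le_ofReal ?_
  simp only [gaussianPDFReal]
  rw [mul_mul_mul_comm, ← Real.exp_add, mul_mul_mul_comm, ← Real.exp_add]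
  refine mul_le_mul_of_nonneg_left (Real.exp_le_exp.2 ?_) (by positivity)
  rw [← add_div, ← add_div]
  refine div_le_div_of_nonneg_right ?_ (by positivity)
  -- After the squares cancel, the claim is `m * (a - b) ≤ 0`.
  nlinarith [mul_nonneg (neg_nonneg.2 hm) (sub_nonneg.2 hab)]

theorem cdf_pos_of_volume_absolutelyContinuous {μ : Measure ℝ} [IsProbabilityMeasure μ]
    (h : volume ≪ μ) (x : ℝ) : 0 < cdf μ x := by
  rw [cdf_eq_real]
  refine ENNReal.toReal_pos (fun h0 => ?_) (measure_ne_top _ _)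
  simpa using h h0

theorem hasLaw_sum_gaussianReal {Ω : Type*} [MeasurableSpace Ω] {P : Measure Ω} {n : ℕ}
    {X : Fin n → Ω → ℝ} {m : ℝ} {v : ℝ≥0} (hX : ∀ i, HasLaw (X i) (gaussianReal m v) P)
    (hi : iIndepFun X P) :
    HasLaw (fun ω => ∑ i, X i ω) (gaussianReal (n * m) (n * v)) P := by
  have hg : ∀ i, HasGaussianLaw (X i) P := fun i => (hX i).hasGaussianLaw
  have hs := hi.hasGaussianLaw_fun_sum hg
  have := hs.isProbabilityMeasure
  refine ⟨hs.aemeasurable, ?_⟩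
  rw [hs.map_eq_gaussianReal]
  have h1 : ∫ ω, ∑ i, X i ω ∂P = n * m := by
    rw [integral_finsetSum _ fun i _ => (hg i).integrable]
    simp [fun i => (hX i).integral_eq]
  have h2 : Var[fun ω => ∑ i, X i ω; P] = n * v := by
    have := IndepFun.variance_sum (s := Finset.univ) (X := X) (μ := P)
      (fun i _ => (hg i).memLp_two) fun i _ j _ hij => hi.indepFun hij
    rw [show (fun ω => ∑ i, X i ω) = ∑ i, X i by ext; simp, this]
    simp [fun i => (hX i).variance_eq]
  rw [h1, h2]
  congr
  ext
  rw [Real.coe_toNNReal _ (by positivity)]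
  simp

theorem hasLaw_sampleMean {Ω : Type*} [MeasurableSpace Ω] {P : Measure Ω} {n : ℕ} (hn : 1 ≤ n)
    {X : Fin n → Ω → ℝ} {m : ℝ} (hX : ∀ i, HasLaw (X i) (gaussianReal m 1) P)
    (hi : iIndepFun X P) :
    HasLaw (sampleMean X) (gaussianReal m (n : ℝ≥0)⁻¹) P := by
  have hn0 : (n : ℝ) ≠ 0 := by positivity
  have h := gaussianReal_const_mul (hasLaw_sum_gaussianReal hX hi) (n : ℝ)⁻¹
  have hv : NNReal.mk ((n : ℝ)⁻¹ ^ 2) (sq_nonneg _) * (n * 1) = (n : ℝ≥0)⁻¹ := by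
    ext
    simp only [NNReal.coe_mul, NNReal.coe_mk, NNReal.coe_natCast, NNReal.coe_one, NNReal.coe_inv]
    field_simp
  rwa [inv_mul_cancel_left₀ hn0, hv] at h

theorem measurable_sampleMean {Ω : Type*} [MeasurableSpace Ω] {n : ℕ} {X : Fin n → Ω → ℝ}
    (hX : ∀ i, Measurable (X i)) : Measurable (sampleMean X) := by
  unfold sampleMean
  fun_prop

theorem isValidPValue_zTests {m : ℕ} {N Ω : Type*} [MeasurableSpace Ω] {n : Fin m → ℕ}
    (hn : ∀ j, 1 ≤ n j) {P : ZParam m N → Measure Ω} {X : (j : Fin m) → Fin (n j) → Ω → ℝ}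
    {U : Fin m → Ω → ℝ} (hP : IsZTestsModel n P X)
    (hU : IsRandomization P (fun ω j i => X j i ω) U) (j : Fin m) {c : ℝ}
    (hc : c ∈ Icc (0 : ℝ) 1) :
    IsValidPValue P (zNull j) fun ω =>
      randPValue (lfcPValue P (zNull j) (sampleMean (X j)) (zRejection (n j)) ω) (U j ω) c := by
  have hv : (n j : ℝ≥0)⁻¹ ≠ 0 := by
    have := hn j
    positivity
  have := nullSingletonClass_gaussianReal (μ := 0) hv
  have hlaw := fun ϑ => hasLaw_sampleMean (hn j) (hP.law ϑ j) (hP.iIndep ϑ j)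
  refine isValidPValue_randPValue (μ := gaussianReal 0 (n j : ℝ≥0)⁻¹)
    (cdf_pos_of_volume_absolutelyContinuous (gaussianReal_absolutelyContinuous' 0 hv))
    (fun _ => rfl) (measurable_sampleMean (hP.measurable j)) hP.isProbabilityMeasure
    (fun ϑ hϑ => ?_) ?_ (fun ϑ => hU.uniform ϑ j) (fun ϑ => ?_) hc
  · rw [(hlaw ϑ).map_eq]
    exact upperTailLE_gaussianReal hϑ hv
  -- The nuisance component is borrowed from a given null parameter, as the nuisance type may be
  -- empty.
  · rintro ⟨ϑ, -⟩
    exact ⟨⟨fun _ => 0, ϑ.nuisance⟩, le_refl (0 : ℝ), (hlaw _).map_eq⟩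
  · exact (hU.indep_data ϑ).comp (φ := fun u : Fin m → ℝ => u j)
      (ψ := fun x : (j : Fin m) → Fin (n j) → ℝ => (n j : ℝ)⁻¹ * ∑ i, x j i)
      (measurable_pi_apply j) (by fun_prop)

/-! ### The noncentral t-distribution -/

section Pi

variable {ι : Type*} [Fintype ι]

/-- It suffices to compare the measures on boxes, where the integral of a product over coordinates
factors. -/
theorem pi_withDensity_volume {f : ℝ → ℝ} (hf : Integrable f) (h0 : ∀ x, 0 ≤ f x)
    [SigmaFinite ((volume : Measure ℝ).withDensity fun x => ENNReal.ofReal (f x))] :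
    Measure.pi (fun _ : ι => (volume : Measure ℝ).withDensity fun x => ENNReal.ofReal (f x)) =
      volume.withDensity fun x : ι → ℝ => ENNReal.ofReal (∏ i, f (x i)) := by
  refine Measure.pi_eq fun s hs => ?_
  rw [withDensity_apply _ (MeasurableSet.univ_pi hs)]
  have hint : ∀ i, Integrable ((s i).indicator f) := fun i => hf.indicator (hs i)
  have hnn : ∀ i x, 0 ≤ (s i).indicator f x := fun i x => indicator_nonneg (fun _ _ => h0 _) x
  have h1 : ∀ i, (volume.withDensity fun x => ENNReal.ofReal (f x)) (s i) =
      ENNReal.ofReal (∫ x, (s i).indicator f x) := fun i => by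
    rw [withDensity_apply _ (hs i), integral_indicator (hs i),
      ofReal_integral_eq_lintegral_ofReal hf.integrableOn (ae_of_all _ h0)]
  simp_rw [h1]
  rw [← ENNReal.ofReal_prod_of_nonneg fun i _ => integral_nonneg (hnn i),
    ← integral_fintype_prod_volume_eq_prod (fun i => (s i).indicator f),
    ofReal_integral_eq_lintegral_ofReal (by
        rw [volume_pi]; exact Integrable.fintype_prod hint)
      (ae_of_all _ fun x => Finset.prod_nonneg fun i _ => hnn i _),
    ← lintegral_indicator (MeasurableSet.univ_pi hs)]
  refine lintegral_congr fun x => ?_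
  by_cases hx : x ∈ univ.pi s
  · rw [indicator_of_mem hx]
    congr 1
    exact Finset.prod_congr rfl fun i _ => (indicator_of_mem (hx i (mem_univ i)) f).symm
  · rw [indicator_of_notMem hx]
    simp only [mem_pi, mem_univ, true_implies, not_forall] at hx
    obtain ⟨i, hi⟩ := hx
    rw [Finset.prod_eq_zero (Finset.mem_univ i) (indicator_of_notMem hi f), ENNReal.ofReal_zero]

theorem pi_gaussianReal_eq_withDensity :
    Measure.pi (fun _ : ι => gaussianReal 0 1) =
      volume.withDensity fun x : ι → ℝ => ENNReal.ofReal (∏ i, gaussianPDFReal 0 1 (x i)) := by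
  have h : gaussianReal 0 1 = volume.withDensity fun x => ENNReal.ofReal (gaussianPDFReal 0 1 x) :=
    gaussianReal_of_var_ne_zero 0 one_ne_zero
  have : SigmaFinite (volume.withDensity fun x => ENNReal.ofReal (gaussianPDFReal 0 1 x)) := by
    rw [← h]; infer_instance
  rw [← pi_withDensity_volume (integrable_gaussianPDFReal 0 1) (gaussianPDFReal_nonneg 0 1), h]

theorem lintegral_comp_smul_pi {f : (ι → ℝ) → ℝ≥0∞} (hf : Measurable f) {r : ℝ} (hr : 0 < r) :
    ∫⁻ x, f x = ENNReal.ofReal (r ^ Fintype.card ι) * ∫⁻ x : ι → ℝ, f (r • x) := by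
  have h := Measure.map_addHaar_smul (volume : Measure (ι → ℝ)) hr.ne'
  rw [← lintegral_map hf (measurable_const_smul r), h, lintegral_smul_measure, smul_eq_mul,
    ← mul_assoc, ← ENNReal.ofReal_mul (by positivity), Module.finrank_fintype_fun_eq_card,
    abs_of_pos (by positivity), mul_inv_cancel₀ (by positivity), ENNReal.ofReal_one, one_mul]

end Pi

/-- The root mean square `√(∑ wᵢ² / ν)`. -/
noncomputable def rms {ν : ℕ} (w : Fin ν → ℝ) : ℝ := √((∑ i, w i ^ 2) / ν)

theorem measurable_rms {ν : ℕ} : Measurable (rms (ν := ν)) := by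
  unfold rms
  fun_prop

theorem rms_nonneg {ν : ℕ} (w : Fin ν → ℝ) : 0 ≤ rms w := Real.sqrt_nonneg _

theorem rms_sq {ν : ℕ} (w : Fin ν → ℝ) : rms w ^ 2 = (∑ i, w i ^ 2) / ν :=
  Real.sq_sqrt (by positivity)

theorem rms_smul {ν : ℕ} {r : ℝ} (hr : 0 ≤ r) (w : Fin ν → ℝ) : rms (r • w) = r * rms w := by
  unfold rms
  rw [← Real.sqrt_sq hr, ← Real.sqrt_mul (sq_nonneg _)]
  simp only [Pi.smul_apply, smul_eq_mul, mul_pow, ← Finset.mul_sum, Real.sqrt_sq hr, mul_div_assoc]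

theorem rms_pos {ν : ℕ} {w : Fin ν → ℝ} {i : Fin ν} (h : w i ≠ 0) : 0 < rms w := by
  have : 0 < ∑ i, w i ^ 2 := Finset.sum_pos' (fun i _ => sq_nonneg _) ⟨i, Finset.mem_univ i, by positivity⟩
  have : 0 < ν := i.pos
  unfold rms
  positivity

theorem ae_rms_pos {ν : ℕ} (hν : 1 ≤ ν) :
    ∀ᵐ w ∂(Measure.pi fun _ : Fin ν => gaussianReal 0 1), 0 < rms w := by
  have := nullSingletonClass_gaussianReal (μ := 0) (v := 1) one_ne_zero
  filter_upwards [Measure.ae_eval_ne (μ := fun _ : Fin ν => gaussianReal 0 1) ⟨0, hν⟩ 0] with w hw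
  exact rms_pos hw

/-- The noncentral t-distribution with `ν` degrees of freedom and noncentrality parameter `δ`. -/
noncomputable def noncentralT (ν : ℕ) (δ : ℝ) : Measure ℝ :=
  ((gaussianReal δ 1).prod (Measure.pi fun _ : Fin ν => gaussianReal 0 1)).map
    fun z => z.1 / rms z.2

theorem noncentralT_zero (ν : ℕ) : noncentralT ν 0 = studentT ν := rfl

theorem measurable_div_rms {ν : ℕ} : Measurable fun z : ℝ × (Fin ν → ℝ) => z.1 / rms z.2 :=
  measurable_fst.div (measurable_rms.comp measurable_snd)

instance isProbabilityMeasure_noncentralT (ν : ℕ) (δ : ℝ) :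
    IsProbabilityMeasure (noncentralT ν δ) :=
  Measure.isProbabilityMeasure_map measurable_div_rms.aemeasurable

instance isProbabilityMeasure_studentT (ν : ℕ) : IsProbabilityMeasure (studentT ν) :=
  isProbabilityMeasure_noncentralT ν 0

/-- The conditional density of the noncentral t-distribution given the denominator `s`. -/
noncomputable def scaledGaussianPDF (δ s t : ℝ) : ℝ≥0∞ :=
  ENNReal.ofReal (s * gaussianPDFReal δ 1 (s * t))

theorem measurable_scaledGaussianPDF (δ : ℝ) :
    Measurable fun p : ℝ × ℝ => scaledGaussianPDF δ p.1 p.2 :=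
  (measurable_fst.mul ((measurable_gaussianPDFReal δ 1).comp
    (measurable_fst.mul measurable_snd))).ennreal_ofReal

theorem gaussianReal_preimage_div_const (δ : ℝ) {s : ℝ} (hs : 0 < s) {A : Set ℝ}
    (hA : MeasurableSet A) :
    gaussianReal δ 1 ((fun z => z / s) ⁻¹' A) = ∫⁻ t in A, scaledGaussianPDF δ s t := by
  have hv : (1 : ℝ≥0) / NNReal.mk (s ^ 2) (sq_nonneg s) ≠ 0 := by
    rw [Ne, ← NNReal.coe_inj]
    simp [hs.ne']
  rw [← Measure.map_apply (f := fun z => z / s) (by fun_prop) hA,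
    gaussianReal_map_div_const, gaussianReal_apply _ hv]
  refine lintegral_congr fun t => ?_
  have h := gaussianPDFReal_inv_mul (μ := δ) (v := 1) (inv_ne_zero hs.ne') t
  rw [gaussianPDF, scaledGaussianPDF]
  rw [inv_inv, abs_of_pos (inv_pos.2 hs)] at h
  rw [h, mul_inv_cancel_left₀ hs.ne', div_eq_inv_mul]
  congr 3
  ext
  simp

/-- The density of the noncentral t-distribution. -/
noncomputable def noncentralTPDF (ν : ℕ) (δ t : ℝ) : ℝ≥0∞ :=
  ∫⁻ w, scaledGaussianPDF δ (rms w) t ∂(Measure.pi fun _ : Fin ν => gaussianReal 0 1)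

theorem measurable_scaledGaussianPDF_rms {ν : ℕ} (δ : ℝ) :
    Measurable fun p : ℝ × (Fin ν → ℝ) => scaledGaussianPDF δ (rms p.2) p.1 :=
  (measurable_scaledGaussianPDF δ).comp ((measurable_rms.comp measurable_snd).prodMk measurable_fst)

theorem measurable_scaledGaussianPDF_rms_left {ν : ℕ} (δ t : ℝ) :
    Measurable fun w : Fin ν → ℝ => scaledGaussianPDF δ (rms w) t := by
  have h : Measurable fun w : Fin ν → ℝ => (rms w, t) := measurable_rms.prodMk measurable_const
  exact (measurable_scaledGaussianPDF δ).comp h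

theorem measurable_noncentralTPDF (ν : ℕ) (δ : ℝ) : Measurable (noncentralTPDF ν δ) :=
  (measurable_scaledGaussianPDF_rms δ).lintegral_prod_right'

/-- Conditionally on the denominator, almost surely positive, the quotient is a rescaled Gaussian;
its density is averaged over the denominator. -/
theorem noncentralT_eq_withDensity {ν : ℕ} (hν : 1 ≤ ν) (δ : ℝ) :
    noncentralT ν δ = volume.withDensity (noncentralTPDF ν δ) := by
  ext A hA
  rw [noncentralT, Measure.map_apply measurable_div_rms hA,
    Measure.prod_apply_symm (measurable_div_rms hA), withDensity_apply _ hA]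
  unfold noncentralTPDF
  rw [lintegral_lintegral_swap (measurable_scaledGaussianPDF_rms δ).aemeasurable]
  refine lintegral_congr_ae ?_
  filter_upwards [ae_rms_pos hν] with w hw
  exact gaussianReal_preimage_div_const δ hw hA

theorem noncentralTPDF_ne_zero {ν : ℕ} (hν : 1 ≤ ν) (δ t : ℝ) : noncentralTPDF ν δ t ≠ 0 := by
  intro h
  rw [noncentralTPDF, lintegral_eq_zero_iff (measurable_scaledGaussianPDF_rms_left δ t)] at h
  obtain ⟨w, h0, hw⟩ := (h.and (ae_rms_pos hν)).exists
  have : 0 < rms w * gaussianPDFReal δ 1 (rms w * t) :=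
    mul_pos hw (gaussianPDFReal_pos _ _ _ one_ne_zero)
  exact (ENNReal.ofReal_pos.2 this).ne' h0

theorem volume_absolutelyContinuous_studentT {ν : ℕ} (hν : 1 ≤ ν) : volume ≪ studentT ν := by
  rw [← noncentralT_zero, noncentralT_eq_withDensity hν]
  exact withDensity_absolutelyContinuous' (measurable_noncentralTPDF ν 0).aemeasurable
    (ae_of_all _ (noncentralTPDF_ne_zero hν 0))

theorem nullSingletonClass_studentT {ν : ℕ} (hν : 1 ≤ ν) : NullSingletonClass (studentT ν) := by
  rw [← noncentralT_zero, noncentralT_eq_withDensity hν]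
  infer_instance

/-- The likelihood ratio of the noncentral and the central t-distribution with `ν` degrees of
freedom, up to normalization, as a function of `x = t / √(t² + ν)`. -/
noncomputable def noncentralTFactor (ν : ℕ) (δ x : ℝ) : ℝ≥0∞ :=
  ∫⁻ u : Fin ν → ℝ, ENNReal.ofReal ((√(2 * Real.pi))⁻¹ * (√(2 * Real.pi))⁻¹ ^ ν *
    (rms u * Real.exp (-rms u ^ 2 / 2 + δ * x * rms u - δ ^ 2 / 2)))

theorem noncentralTFactor_antitone (ν : ℕ) {δ : ℝ} (hδ : δ ≤ 0) :
    Antitone (noncentralTFactor ν δ) := by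
  intro x y hxy
  refine lintegral_mono fun u => ENNReal.ofReal_le_ofReal ?_
  have hu := rms_nonneg u
  have h : δ * y * rms u ≤ δ * x * rms u :=
    mul_le_mul_of_nonneg_right (mul_le_mul_of_nonpos_left hxy hδ) hu
  gcongr

theorem noncentralTFactor_zero (ν : ℕ) (x : ℝ) :
    noncentralTFactor ν 0 x = noncentralTFactor ν 0 0 := by
  simp [noncentralTFactor]

/-- With `s = rms u / ρ`, the quadratic terms `(s t)²` and `ν s²` of the two exponents combine to
`ρ² s² = rms u ^ 2`, so that `t` survives only in the cross term, through `t / ρ`. -/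
theorem prod_gaussianPDFReal_mul {ν : ℕ} (hν : 1 ≤ ν) (δ t : ℝ) {ρ : ℝ} (hρ : 0 < ρ)
    (hρ2 : ρ ^ 2 = t ^ 2 + ν) (u : Fin ν → ℝ) :
    (∏ i, gaussianPDFReal 0 1 (ρ⁻¹ * u i)) *
        (ρ⁻¹ * rms u * gaussianPDFReal δ 1 (ρ⁻¹ * rms u * t)) =
      ρ⁻¹ * ((√(2 * Real.pi))⁻¹ * (√(2 * Real.pi))⁻¹ ^ ν *
        (rms u * Real.exp (-rms u ^ 2 / 2 + δ * (t / ρ) * rms u - δ ^ 2 / 2))) := by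
  have hν' : (ν : ℝ) ≠ 0 := by positivity
  have hsum : ∑ i, (ρ⁻¹ * u i) ^ 2 = ν * (ρ⁻¹ * rms u) ^ 2 := by
    have h : ∑ i, u i ^ 2 = ν * rms u ^ 2 := by rw [rms_sq, mul_div_cancel₀ _ hν']
    simp only [mul_pow]
    rw [← Finset.mul_sum, h]
    ring
  have hexp : -(ρ⁻¹ * rms u * t - δ) ^ 2 / 2 + -(∑ i, (ρ⁻¹ * u i) ^ 2) / 2 =
      -rms u ^ 2 / 2 + δ * (t / ρ) * rms u - δ ^ 2 / 2 := by
    have h : rms u ^ 2 = ρ ^ 2 * (ρ⁻¹ * rms u) ^ 2 := by field_simp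
    rw [hsum, h, hρ2, div_eq_mul_inv t]
    ring
  have hprod : ∏ i, gaussianPDFReal 0 1 (ρ⁻¹ * u i) =
      (√(2 * Real.pi))⁻¹ ^ ν * Real.exp (-(∑ i, (ρ⁻¹ * u i) ^ 2) / 2) := by
    simp only [gaussianPDFReal, NNReal.coe_one, mul_one, sub_zero, Finset.prod_mul_distrib,
      Finset.prod_const, Finset.card_univ, Fintype.card_fin, ← Real.exp_sum, ← Finset.sum_div,
      Finset.sum_neg_distrib]
  rw [hprod, ← hexp, Real.exp_add, gaussianPDFReal, NNReal.coe_one, mul_one, mul_one]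
  ring

/-- Substitute `w = u / ρ` with `ρ = √(t² + ν)`. The Jacobian supplies `ρ⁻¹ ^ ν`, and the factor
`rms w` of the conditional density supplies one more `ρ⁻¹`. -/
theorem noncentralTPDF_eq {ν : ℕ} (hν : 1 ≤ ν) (δ t : ℝ) :
    noncentralTPDF ν δ t = ENNReal.ofReal ((√(t ^ 2 + ν))⁻¹ ^ (ν + 1)) *
      noncentralTFactor ν δ (t / √(t ^ 2 + ν)) := by
  have hν' : (0 : ℝ) < ν := by positivity
  obtain ⟨ρ, hρe⟩ : ∃ ρ, ρ = √(t ^ 2 + ν) := ⟨_, rfl⟩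
  have hρ : 0 < ρ := hρe ▸ Real.sqrt_pos.2 (by positivity)
  have hρ2 : ρ ^ 2 = t ^ 2 + ν := hρe ▸ Real.sq_sqrt (by positivity)
  have hd : Measurable fun x : Fin ν → ℝ => ENNReal.ofReal (∏ i, gaussianPDFReal 0 1 (x i)) :=
    (Finset.measurable_fun_prod _ fun i _ =>
      (measurable_gaussianPDFReal 0 1).comp (measurable_pi_apply i)).ennreal_ofReal
  have hs := measurable_scaledGaussianPDF_rms_left (ν := ν) δ t
  rw [← hρe, noncentralTPDF, pi_gaussianReal_eq_withDensity,
    lintegral_withDensity_eq_lintegral_mul _ hd hs,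
    lintegral_comp_smul_pi (hd.mul hs) (inv_pos.2 hρ), Fintype.card_fin, pow_succ,
    ENNReal.ofReal_mul (by positivity), mul_assoc, noncentralTFactor]
  congr 1
  rw [← lintegral_const_mul' _ _ ENNReal.ofReal_ne_top]
  refine lintegral_congr fun u => ?_
  rw [Pi.mul_apply, scaledGaussianPDF, rms_smul (inv_pos.2 hρ).le,
    ← ENNReal.ofReal_mul (Finset.prod_nonneg fun i _ => gaussianPDFReal_nonneg _ _ _),
    ← ENNReal.ofReal_mul (inv_pos.2 hρ).le, ← prod_gaussianPDFReal_mul hν δ t hρ hρ2]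
  rfl

theorem monotone_div_sqrt_sq_add {ν : ℝ} (hν : 0 < ν) :
    Monotone fun t : ℝ => t / √(t ^ 2 + ν) := by
  have hpos : ∀ t : ℝ, 0 < √(t ^ 2 + ν) := fun t => Real.sqrt_pos.2 (by positivity)
  have hsq : ∀ t : ℝ, √(t ^ 2 + ν) ^ 2 = t ^ 2 + ν := fun t => Real.sq_sqrt (by positivity)
  refine monotone_of_odd_of_monotoneOn_nonneg (fun t => ?_) fun b hb a _ hab => ?_
  · simp [neg_div]
  · have hb' : 0 ≤ b := hb
    have ha := hb'.trans hab
    rw [div_le_div_iff₀ (hpos b) (hpos a)]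
    refine le_of_sq_le_sq ?_ (mul_nonneg ha (hpos b).le)
    rw [mul_pow, mul_pow, hsq, hsq]
    nlinarith [mul_le_mul hab hab hb' ha]

/-- The powers of `√(t² + ν)` are common to both densities and the central factor is constant, so
the ratio varies with `t` only through an antitone function of the increasing quantity `t / √(t² +
ν)`. -/
theorem upperTailLE_noncentralT {ν : ℕ} (hν : 1 ≤ ν) {δ : ℝ} (hδ : δ ≤ 0) :
    UpperTailLE (noncentralT ν δ) (studentT ν) := by
  rw [← noncentralT_zero, noncentralT_eq_withDensity hν, noncentralT_eq_withDensity hν]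
  refine upperTailLE_withDensity (measurable_noncentralTPDF ν δ) (measurable_noncentralTPDF ν 0)
    fun a b hab => ?_
  simp only [noncentralTPDF_eq hν, noncentralTFactor_zero ν (_ / _)]
  have h := noncentralTFactor_antitone ν hδ
    (monotone_div_sqrt_sq_add (ν := ν) (by positivity) hab)
  simp only at h
  calc _ = ENNReal.ofReal ((√(a ^ 2 + ν))⁻¹ ^ (ν + 1)) * ENNReal.ofReal ((√(b ^ 2 + ν))⁻¹ ^ (ν + 1)) *
        noncentralTFactor ν 0 0 * noncentralTFactor ν δ (a / √(a ^ 2 + ν)) := by ring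
    _ ≤ ENNReal.ofReal ((√(a ^ 2 + ν))⁻¹ ^ (ν + 1)) * ENNReal.ofReal ((√(b ^ 2 + ν))⁻¹ ^ (ν + 1)) *
        noncentralTFactor ν 0 0 * noncentralTFactor ν δ (b / √(b ^ 2 + ν)) := by gcongr
    _ = _ := by ring

/-! ### The law of the two-sample t-statistic -/

open scoped RealInnerProductSpace in
/-- An orthonormal basis whose first vector is the normalized contrast of the two sample means and
whose remaining vectors, except the second one, span the within-sample deviations. -/
theorem exists_orthonormalBasis_twoSample {n₁ n₂ ν : ℕ} (h₁ : 1 ≤ n₁) (h₂ : 1 ≤ n₂)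
    (hν : n₁ + n₂ = ν + 2) :
    ∃ b : OrthonormalBasis (Option (Option (Fin ν))) ℝ (EuclideanSpace ℝ (Fin n₁ ⊕ Fin n₂)),
      ∀ (x : Fin n₁ → ℝ) (y : Fin n₂ → ℝ),
        ⟪b none, WithLp.toLp 2 (Sum.elim x y)⟫ = √((n₁ : ℝ) * n₂ / (n₁ + n₂)) *
          ((n₁ : ℝ)⁻¹ * ∑ i, x i - (n₂ : ℝ)⁻¹ * ∑ i, y i) ∧
        ∑ i, ⟪b (some (some i)), WithLp.toLp 2 (Sum.elim x y)⟫ ^ 2 =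
          ∑ i, (x i - (n₁ : ℝ)⁻¹ * ∑ i, x i) ^ 2 + ∑ i, (y i - (n₂ : ℝ)⁻¹ * ∑ i, y i) ^ 2 := by
  have p₁ : (0 : ℝ) < n₁ := by positivity
  have p₂ : (0 : ℝ) < n₂ := by positivity
  set r := √((n₁ : ℝ) * n₂ / (n₁ + n₂)) with hr
  have hr2 : r ^ 2 = (n₁ : ℝ) * n₂ / (n₁ + n₂) := Real.sq_sqrt (by positivity)
  set q := √((n₁ : ℝ) + n₂) with hq
  have hq2 : q ^ 2 = n₁ + n₂ := Real.sq_sqrt (by positivity)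
  have hq0 : q ≠ 0 := (Real.sqrt_pos.2 (by positivity)).ne'
  -- `e₀` is the contrast of the sample means and `e₁` the constant direction; together they span
  -- the vectors that are constant on each sample.
  let e₀ : EuclideanSpace ℝ (Fin n₁ ⊕ Fin n₂) :=
    WithLp.toLp 2 (Sum.elim (fun _ => r / n₁) fun _ => -(r / n₂))
  let e₁ : EuclideanSpace ℝ (Fin n₁ ⊕ Fin n₂) := WithLp.toLp 2 (Sum.elim (fun _ => q⁻¹) fun _ => q⁻¹)
  have hin : ∀ (x x' : Fin n₁ → ℝ) (y y' : Fin n₂ → ℝ),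
      ⟪(WithLp.toLp 2 (Sum.elim x y) : EuclideanSpace ℝ (Fin n₁ ⊕ Fin n₂)),
        WithLp.toLp 2 (Sum.elim x' y')⟫ = ∑ i, x i * x' i + ∑ i, y i * y' i := fun x x' y y' => by
    simp [PiLp.inner_apply, Fintype.sum_sum_type, mul_comm]
  have h00 : ⟪e₀, e₀⟫ = 1 := by
    simp only [e₀, hin, Finset.sum_const, Finset.card_univ, Fintype.card_fin, nsmul_eq_mul]
    have : (n₁ : ℝ) * (r / n₁ * (r / n₁)) + n₂ * (-(r / n₂) * -(r / n₂)) =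
      r ^ 2 * (1 / n₁ + 1 / n₂) := by field_simp
    rw [this, hr2]
    field_simp
    ring
  have h11 : ⟪e₁, e₁⟫ = 1 := by
    simp only [e₁, hin, Finset.sum_const, Finset.card_univ, Fintype.card_fin, nsmul_eq_mul]
    field_simp
    rw [hq2]
  have h01 : ⟪e₀, e₁⟫ = 0 := by
    simp only [e₀, e₁, hin, Finset.sum_const, Finset.card_univ, Fintype.card_fin, nsmul_eq_mul]
    field_simp
    ring
  let v : Option (Option (Fin ν)) → EuclideanSpace ℝ (Fin n₁ ⊕ Fin n₂)
    | none => e₀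
    | some none => e₁
    | some (some _) => 0
  have hv : Orthonormal ℝ (({none, some none} : Set (Option (Option (Fin ν)))).domRestrict v) := by
    rw [orthonormal_iff_ite]
    rintro ⟨i, rfl | rfl⟩ ⟨j, rfl | rfl⟩
    · simpa [v] using h00
    · exact h01.trans (if_neg fun h => Option.some_ne_none _ (congrArg Subtype.val h).symm).symm
    · exact (real_inner_comm _ _).trans
        (h01.trans (if_neg fun h => Option.some_ne_none _ (congrArg Subtype.val h)).symm)
    · simpa [v] using h11
  obtain ⟨b, hb⟩ := hv.exists_orthonormalBasis_extension_of_card_eq (by simp [hν])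
  have hb0 : b none = e₀ := hb _ (by simp)
  have hb1 : b (some none) = e₁ := hb _ (by simp)
  refine ⟨b, fun x y => ?_⟩
  have hx0 : ⟪b none, WithLp.toLp 2 (Sum.elim x y)⟫ =
      r * ((n₁ : ℝ)⁻¹ * ∑ i, x i - (n₂ : ℝ)⁻¹ * ∑ i, y i) := by
    simp only [hb0, e₀, hin, ← Finset.mul_sum]
    ring
  refine ⟨hx0, ?_⟩
  have hx1 : ⟪b (some none), WithLp.toLp 2 (Sum.elim x y)⟫ = q⁻¹ * (∑ i, x i + ∑ i, y i) := by
    simp only [hb1, e₁, hin, ← Finset.mul_sum]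
    ring
  -- By Parseval, the remaining squared coordinates sum to the squared norm minus the first two
  -- squares; `halg` identifies those two with the squared-mean terms of the deviation sums.
  have hsum := b.sum_sq_inner_right (WithLp.toLp 2 (Sum.elim x y))
  rw [Fintype.sum_option, Fintype.sum_option, hx0, hx1, ← real_inner_self_eq_norm_sq, hin,
    mul_pow, mul_pow, hr2, inv_pow, hq2] at hsum
  have hdev : ∀ {n : ℕ} (_ : (0 : ℝ) < n) (x : Fin n → ℝ),
      ∑ i, (x i - (n : ℝ)⁻¹ * ∑ i, x i) ^ 2 = ∑ i, x i * x i - (n : ℝ)⁻¹ * (∑ i, x i) ^ 2 := by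
    intro n hn x
    simp only [sub_sq, Finset.sum_add_distrib, Finset.sum_sub_distrib, Finset.sum_const,
      Finset.card_univ, Fintype.card_fin, nsmul_eq_mul, ← Finset.sum_mul, ← Finset.mul_sum,
      ← pow_two]
    field_simp
    ring
  rw [hdev p₁, hdev p₂]
  have halg : (n₁ : ℝ) * n₂ / (n₁ + n₂) * ((n₁ : ℝ)⁻¹ * ∑ i, x i - (n₂ : ℝ)⁻¹ * ∑ i, y i) ^ 2 +
      (n₁ + n₂ : ℝ)⁻¹ * (∑ i, x i + ∑ i, y i) ^ 2 =
      (n₁ : ℝ)⁻¹ * (∑ i, x i) ^ 2 + (n₂ : ℝ)⁻¹ * (∑ i, y i) ^ 2 := by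
    field_simp
    ring
  linarith

open scoped RealInnerProductSpace in
-- Coordinates in an orthonormal basis form a linear isometry, which preserves the standard Gaussian
-- measure.
theorem measurePreserving_inner_orthonormalBasis {ι κ : Type*} [Fintype ι] [Fintype κ]
    (b : OrthonormalBasis κ ℝ (EuclideanSpace ℝ ι)) :
    MeasurePreserving (fun (g : ι → ℝ) k => ⟪b k, WithLp.toLp 2 g⟫)
      (Measure.pi fun _ => gaussianReal 0 1) (Measure.pi fun _ => gaussianReal 0 1) := by
  have h : (fun (g : ι → ℝ) k => ⟪b k, WithLp.toLp 2 g⟫) =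
      (WithLp.ofLp : EuclideanSpace ℝ κ → κ → ℝ) ∘ b.repr ∘ WithLp.toLp 2 := by
    ext g k
    simp [b.repr_apply_apply]
  rw [h]
  refine ⟨by fun_prop, ?_⟩
  rw [← Measure.map_map (by fun_prop) (by fun_prop), ← Measure.map_map (by fun_prop) (by fun_prop),
    map_pi_eq_stdGaussian, stdGaussian_map, ← map_pi_eq_stdGaussian,
    Measure.map_map (by fun_prop) (by fun_prop)]
  exact Measure.map_id

theorem measurePreserving_option {ι : Type*} [Fintype ι] (μ : Measure ℝ) [IsProbabilityMeasure μ] :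
    MeasurePreserving (fun x : Option ι → ℝ => (x none, fun i => x (some i)))
      (Measure.pi fun _ => μ) (μ.prod (Measure.pi fun _ => μ)) := by
  have h : MeasurePreserving (MeasurableEquiv.piOptionEquivProd fun _ : Option ι => ℝ).symm
      ((Measure.pi fun _ => μ).prod μ) (Measure.pi fun _ => μ) :=
    ⟨MeasurableEquiv.measurable _, Measure.pi_map_piOptionEquivProd fun _ => μ⟩
  exact Measure.measurePreserving_swap.comp h.symm

theorem hasLaw_standardize {Ω : Type*} [MeasurableSpace Ω] {P : Measure Ω} {X : Ω → ℝ} {m : ℝ}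
    {v : ℝ≥0} (hv : 0 < v) (h : HasLaw X (gaussianReal m v) P) :
    HasLaw (fun ω => (X ω - m) / √v) (gaussianReal 0 1) P := by
  have h' := gaussianReal_div_const (gaussianReal_sub_const h m) (√v)
  have h1 : v / NNReal.mk (√(v : ℝ) ^ 2) (sq_nonneg _) = 1 := by
    ext
    simp [hv.ne']
  rwa [sub_self, zero_div, h1] at h'

theorem measurePreserving_noncentralT (ν : ℕ) (δ : ℝ) :
    MeasurePreserving (fun z : ℝ × (Fin ν → ℝ) => (z.1 + δ) / rms z.2)
      ((gaussianReal 0 1).prod (Measure.pi fun _ => gaussianReal 0 1)) (noncentralT ν δ) := by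
  have h : MeasurePreserving (fun z : ℝ => z + δ) (gaussianReal 0 1) (gaussianReal δ 1) :=
    ⟨by fun_prop, by rw [gaussianReal_map_add_const, zero_add]⟩
  have h2 : MeasurePreserving (fun z : ℝ × (Fin ν → ℝ) => z.1 / rms z.2)
      ((gaussianReal δ 1).prod (Measure.pi fun _ => gaussianReal 0 1)) (noncentralT ν δ) :=
    ⟨measurable_div_rms, rfl⟩
  exact h2.comp (h.prod (MeasurePreserving.id _))

/-- The noncentrality parameter of the two-sample t-statistic. -/
noncomputable def noncentrality (n₁ n₂ : ℕ) (m₁ m₂ : ℝ) (v : ℝ≥0) : ℝ :=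
  √((n₁ : ℝ) * n₂ / (n₁ + n₂)) * (m₁ - m₂) / √v

open scoped RealInnerProductSpace in
theorem hasLaw_tStatistic {Ω : Type*} [MeasurableSpace Ω] {P : Measure Ω} {n₁ n₂ : ℕ}
    (h₁ : 1 ≤ n₁) (h₂ : 1 ≤ n₂) (h₃ : 3 ≤ n₁ + n₂) {X : Fin n₁ → Ω → ℝ} {Y : Fin n₂ → Ω → ℝ}
    {m₁ m₂ : ℝ} {v : ℝ≥0} (hv : 0 < v) (hX : ∀ i, HasLaw (X i) (gaussianReal m₁ v) P)
    (hY : ∀ i, HasLaw (Y i) (gaussianReal m₂ v) P) (hi : iIndepFun (Sum.elim X Y) P) :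
    HasLaw (tStatistic X Y) (noncentralT (n₁ + n₂ - 2) (noncentrality n₁ n₂ m₁ m₂ v)) P := by
  obtain ⟨ν, hν⟩ : ∃ ν, n₁ + n₂ = ν + 2 := ⟨n₁ + n₂ - 2, by omega⟩
  rw [hν, Nat.add_sub_cancel]
  have p₁ : (n₁ : ℝ) ≠ 0 := by positivity
  have p₂ : (n₂ : ℝ) ≠ 0 := by positivity
  have hs : 0 < √(v : ℝ) := Real.sqrt_pos.2 hv
  obtain ⟨b, hb⟩ := exists_orthonormalBasis_twoSample h₁ h₂ hν
  let mean : Fin n₁ ⊕ Fin n₂ → ℝ := Sum.elim (fun _ => m₁) fun _ => m₂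
  let G : Ω → Fin n₁ ⊕ Fin n₂ → ℝ := fun ω i => (Sum.elim X Y i ω - mean i) / √v
  have hG : HasLaw G (Measure.pi fun _ => gaussianReal 0 1) P := by
    refine iIndepFun.hasLaw_pi (X := fun i ω => (Sum.elim X Y i ω - mean i) / √v) ?_
      (hi.comp (fun i x => (x - mean i) / √v) fun i => by fun_prop)
    rintro (i | i)
    · exact hasLaw_standardize hv (hX i)
    · exact hasLaw_standardize hv (hY i)
  -- Rotate, split off the contrast coordinate, discard the coordinate of the overall mean, and form
  -- the shifted quotient from the rest.
  have hmp := (measurePreserving_noncentralT ν (noncentrality n₁ n₂ m₁ m₂ v)).comp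
    (((MeasurePreserving.id _).prod ((measurePreserving_snd).comp
      (measurePreserving_option (ι := Fin ν) (gaussianReal 0 1)))).comp
      ((measurePreserving_option (gaussianReal 0 1)).comp
        (measurePreserving_inner_orthonormalBasis b)))
  refine (hmp.comp_hasLaw hG).congr (ae_of_all _ fun ω => ?_)
  have hz : (WithLp.toLp 2 (Sum.elim (fun i => X i ω) fun i => Y i ω) :
      EuclideanSpace ℝ (Fin n₁ ⊕ Fin n₂)) = √(v : ℝ) • WithLp.toLp 2 (G ω) + WithLp.toLp 2 mean := by
    ext i
    rcases i with i | i <;> simp [G, mean] <;> field_simp <;> ring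
  have hinner : ∀ k, ⟪b k, WithLp.toLp 2 (Sum.elim (fun i => X i ω) fun i => Y i ω)⟫ =
      √(v : ℝ) * ⟪b k, WithLp.toLp 2 (G ω)⟫ + ⟪b k, WithLp.toLp 2 mean⟫ := fun k => by
    rw [hz, inner_add_right, inner_smul_right]
  obtain ⟨hm0, hm1⟩ := hb (fun _ => m₁) fun _ => m₂
  obtain ⟨hz0, hz1⟩ := hb (fun i => X i ω) fun i => Y i ω
  -- The mean vector, viewed as a sample, has no within-sample deviations, so the denominator
  -- coordinates are centred.
  have hmean : ∀ i, ⟪b (some (some i)), WithLp.toLp 2 mean⟫ = 0 := by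
    simp only [Finset.sum_const, Finset.card_univ, Fintype.card_fin, nsmul_eq_mul,
      inv_mul_cancel_left₀ p₁, inv_mul_cancel_left₀ p₂, sub_self, ne_eq, OfNat.ofNat_ne_zero,
      not_false_eq_true, zero_pow, mul_zero, add_zero] at hm1
    intro i
    exact pow_eq_zero_iff two_ne_zero |>.1
      ((Finset.sum_eq_zero_iff_of_nonneg fun i _ => sq_nonneg _).1 hm1 i (Finset.mem_univ i))
  simp only [Finset.sum_const, Finset.card_univ, Fintype.card_fin, nsmul_eq_mul,
    inv_mul_cancel_left₀ p₁, inv_mul_cancel_left₀ p₂] at hm0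
  have hnum : √((n₁ : ℝ) * n₂ / (n₁ + n₂)) * (sampleMean X ω - sampleMean Y ω) =
      √(v : ℝ) * (⟪b none, WithLp.toLp 2 (G ω)⟫ + noncentrality n₁ n₂ m₁ m₂ v) := by
    rw [sampleMean, sampleMean, ← hz0, hinner, hm0, noncentrality]
    field_simp
  have hden : √(pooledVariance X Y ω) =
      √(v : ℝ) * rms fun i => ⟪b (some (some i)), WithLp.toLp 2 (G ω)⟫ := by
    have hν' : (n₁ : ℝ) + n₂ - 2 = ν := by
      have : ((n₁ + n₂ : ℕ) : ℝ) = (ν + 2 : ℕ) := by rw [hν]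
      push_cast at this
      linarith
    rw [← Real.sqrt_sq hs.le, rms, ← Real.sqrt_mul (sq_nonneg _)]
    congr 1
    rw [pooledVariance, hν']
    simp only [sampleMean]
    rw [← hz1]
    simp only [hinner, hmean, add_zero, mul_pow, ← Finset.mul_sum]
    ring
  rw [tStatistic, hnum, hden, mul_div_mul_left _ _ hs.ne']
  rfl

theorem measurable_tStatistic {Ω : Type*} [MeasurableSpace Ω] {n₁ n₂ : ℕ} {X : Fin n₁ → Ω → ℝ}
    {Y : Fin n₂ → Ω → ℝ} (hX : ∀ i, Measurable (X i)) (hY : ∀ i, Measurable (Y i)) :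
    Measurable (tStatistic X Y) := by
  unfold tStatistic pooledVariance sampleMean
  fun_prop

theorem isValidPValue_twoSample {m : ℕ} {N Ω : Type*} [MeasurableSpace Ω] {n₁ n₂ : Fin m → ℕ}
    (h₁ : ∀ j, 1 ≤ n₁ j) (h₂ : ∀ j, 1 ≤ n₂ j) (h₃ : ∀ j, 3 ≤ n₁ j + n₂ j)
    {P : TwoSampleParam m N → Measure Ω} {X : (j : Fin m) → Fin (n₁ j) → Ω → ℝ}
    {Y : (j : Fin m) → Fin (n₂ j) → Ω → ℝ} {U : Fin m → Ω → ℝ} (hP : IsTwoSampleModel n₁ n₂ P X Y)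
    (hU : IsRandomization P (fun ω => (fun j i => X j i ω, fun j i => Y j i ω) :
      Ω → ((j : Fin m) → Fin (n₁ j) → ℝ) × ((j : Fin m) → Fin (n₂ j) → ℝ)) U)
    (j : Fin m) {c : ℝ} (hc : c ∈ Icc (0 : ℝ) 1) :
    IsValidPValue P (twoSampleNull j) fun ω =>
      randPValue (lfcPValue P (twoSampleNull j) (tStatistic (X j) (Y j))
        (tRejection (n₁ j) (n₂ j)) ω) (U j ω) c := by
  have hν : 1 ≤ n₁ j + n₂ j - 2 := by have := h₃ j; omega
  have := nullSingletonClass_studentT hν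
  have hlaw := fun ϑ => hasLaw_tStatistic (h₁ j) (h₂ j) (h₃ j) (ϑ.var_pos j)
    (hP.law_fst ϑ j) (hP.law_snd ϑ j) (hP.iIndep ϑ j)
  refine isValidPValue_randPValue (μ := studentT (n₁ j + n₂ j - 2))
    (cdf_pos_of_volume_absolutelyContinuous (volume_absolutelyContinuous_studentT hν))
    (fun _ => rfl) (measurable_tStatistic (hP.measurable_fst j) (hP.measurable_snd j))
    hP.isProbabilityMeasure (fun ϑ hϑ => ?_) ?_ (fun ϑ => hU.uniform ϑ j) (fun ϑ => ?_) hc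
  · rw [(hlaw ϑ).map_eq]
    exact upperTailLE_noncentralT hν (div_nonpos_of_nonpos_of_nonneg
      (mul_nonpos_of_nonneg_of_nonpos (Real.sqrt_nonneg _) hϑ) (Real.sqrt_nonneg _))
  · rintro ⟨ϑ, -⟩
    -- Equal means give noncentrality `0` whatever the variance, so the variances may be kept.
    refine ⟨⟨fun _ => 0, fun _ => 0, ϑ.var, ϑ.var_pos, ϑ.nuisance⟩, ?_, ?_⟩
    · exact (sub_self (0 : ℝ)).le
    · rw [(hlaw _).map_eq, noncentrality, sub_self, mul_zero, zero_div, noncentralT_zero]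
  · have hψ : Measurable (tStatistic (n₁ := n₁ j) (n₂ := n₂ j)
        (Ω := ((j : Fin m) → Fin (n₁ j) → ℝ) × ((j : Fin m) → Fin (n₂ j) → ℝ))
        (fun i z => z.1 j i) fun i z => z.2 j i) :=
      measurable_tStatistic
        (fun i => (measurable_pi_apply i).comp ((measurable_pi_apply j).comp measurable_fst))
        fun i => (measurable_pi_apply i).comp ((measurable_pi_apply j).comp measurable_snd)
    have hφ : Measurable fun u : Fin m → ℝ => u j := measurable_pi_apply j
    exact (hU.indep_data ϑ).comp hφ hψ

theorem mainTheorem3 {m : ℕ} (c : Fin m → ℝ) (hc : ∀ j, c j ∈ Set.Icc (0 : ℝ) 1) :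
    (∀ {N Ω : Type*} [MeasurableSpace Ω] (n : Fin m → ℕ) (_ : ∀ j, 1 ≤ n j)
        (P : ZParam m N → Measure Ω) (X : (j : Fin m) → Fin (n j) → Ω → ℝ)
        (U : Fin m → Ω → ℝ)
        (_ : IsZTestsModel n P X)
        (_ : IsRandomization P (fun ω j i => X j i ω) U) (j : Fin m),
        IsValidPValue P (zNull j) fun ω =>
          randPValue (lfcPValue P (zNull j) (sampleMean (X j)) (zRejection (n j)) ω)
            (U j ω) (c j)) ∧
    (∀ {N Ω : Type*} [MeasurableSpace Ω] (n₁ n₂ : Fin m → ℕ)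
        (_ : ∀ j, 1 ≤ n₁ j) (_ : ∀ j, 1 ≤ n₂ j) (_ : ∀ j, 3 ≤ n₁ j + n₂ j)
        (P : TwoSampleParam m N → Measure Ω) (X : (j : Fin m) → Fin (n₁ j) → Ω → ℝ)
        (Y : (j : Fin m) → Fin (n₂ j) → Ω → ℝ) (U : Fin m → Ω → ℝ)
        (_ : IsTwoSampleModel n₁ n₂ P X Y)
        (_ : IsRandomization P (fun ω => (fun j i => X j i ω, fun j i => Y j i ω) :
          Ω → ((j : Fin m) → Fin (n₁ j) → ℝ) × ((j : Fin m) → Fin (n₂ j) → ℝ)) U)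
        (j : Fin m),
        IsValidPValue P (twoSampleNull j) fun ω =>
          randPValue (lfcPValue P (twoSampleNull j) (tStatistic (X j) (Y j))
            (tRejection (n₁ j) (n₂ j)) ω) (U j ω) (c j)) := by
  exact ⟨fun _ hn _ _ _ hP hU j => isValidPValue_zTests hn hP hU j (hc j),
    fun _ _ h₁ h₂ h₃ _ _ _ _ hP hU j => isValidPValue_twoSample h₁ h₂ h₃ hP hU j (hc j)⟩
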